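/- Let $d_1,d_2\ge 0$ be integers, $\mathcal X=\mathbb R^{d_1}$, $\mathcal Y=\mathbb R^{d_2}$, and let $P_{XY}$ be a Borel probability measure on $\mathcal X\times\mathcal Y$ that is absolutely continuous with respect to Lebesgue measure, with marginal $P_X$ on $\mathcal X$. The umlaut information is $$U(X;Y):=\inf_{\nu} D(P_X\times\nu\,\|\,P_{XY})\in[0,+\infty],$$ where $\nu$ ranges over all probability measures on $\mathcal Y$ and $D$ is the relative entropy: $D(P\|Q)=\int \log\frac{dP}{dQ}\,dP$ if $P\ll Q$, and $D(P\|Q)=+\infty$ otherwise. For $n\ge 1$ let $\mathcal F_n^{P_X}:=\{P_X^{\times n}\times Q_{Y^n} : Q_{Y^n}\text{ a probability measure on }\mathcal Y^n\}$, a set of probability measures on $\mathcal X^n\times\mathcal Y^n\cong(\mathcal X\times\mathcal Y)^n$. A (randomised) test is a measurable function $A:(\mathcal X\times\mathcal Y)^n\to[0,1]$, where $A(z)$ is the probability of guessing the null hypothesis $H_0$ (the law of the sample lies in $\mathcal F_n^{P_X}$) and $1-A(z)$ that of guessing $H_1$ (the law of the sample is $P_{XY}^{\times n}$) upon observing $z$.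 Its type-I and type-II errors are $$\alpha(A)=\sup_{R\in\mathcal F_n^{P_X}}\int(1-A)\,dR,\qquad \beta(A)=\int A\,dP_{XY}^{\times n}.$$ For $\epsilon\in(0,1)$ put $D_H^\epsilon(\mathcal F_n^{P_X}\|P_{XY}^{\times n}):=-\log\inf\{\beta(A): A \text{ a test with } \alpha(A)\le\epsilon\}\in[0,+\infty]$. **Theorem.** The Stein exponent $$\mathrm{Stein}(\mathcal F^{P_X}\|P_{XY}):=\lim_{\epsilon\to0^+}\liminf_{n\to\infty}\frac1n D_H^\epsilon(\mathcal F_n^{P_X}\|P_{XY}^{\times n})$$ exists in $[0,+\infty]$ and $$\mathrm{Stein}(\mathcal F^{P_X}\|P_{XY})=U(X;Y).$$ -/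

import Mathlib

open MeasureTheory Filter Topology
open scoped ENNReal

namespace Umlaut

noncomputable section

/-- The umlaut information of a joint law `μ` on `𝒳 × 𝒴` with first marginal `μ.fst`: the infimum of
the relative entropy `D(μ_X × ν ‖ μ)` over all probability measures `ν` on `𝒴`. -/
def umlautInformation {𝒳 𝒴 : Type*} [MeasurableSpace 𝒳] [MeasurableSpace 𝒴]
    (μ : Measure (𝒳 × 𝒴)) : ℝ≥0∞ :=
  ⨅ ν : ProbabilityMeasure 𝒴, InformationTheory.klDiv (μ.fst.prod (ν : Measure 𝒴)) μ

/-- A (randomised) test on `Ω`: `A ω` is the probability of guessing the null hypothesis `H₀`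
when `ω` is observed, and `1 - A ω` that of guessing the alternative hypothesis `H₁`. -/
structure IsTest {Ω : Type*} [MeasurableSpace Ω] (A : Ω → ℝ≥0∞) : Prop where
  measurable : Measurable A
  le_one : ∀ ω, A ω ≤ 1

/-- Type-I error of a test for the composite null hypothesis `F`: the worst-case probability of
guessing `H₁` when the sample is distributed according to some element of `F`. -/
def typeIError {Ω : Type*} [MeasurableSpace Ω] (F : Set (Measure Ω)) (A : Ω → ℝ≥0∞) : ℝ≥0∞ :=
  ⨆ Q ∈ F, ∫⁻ ω, (1 - A ω) ∂Q

/-- Type-II error of a test for the simple alternative hypothesis `P`: the probability of guessing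
`H₀` when the sample is distributed according to `P`. -/
def typeIIError {Ω : Type*} [MeasurableSpace Ω] (P : Measure Ω) (A : Ω → ℝ≥0∞) : ℝ≥0∞ :=
  ∫⁻ ω, A ω ∂P

/-- The hypothesis testing relative entropy `D_H^ε(F ‖ P)`: minus the logarithm of the least
type-II error of a test whose type-I error is at most `ε` (it is `⊤` when that error is zero). -/
def hypothesisTestingEntropy {Ω : Type*} [MeasurableSpace Ω]
    (ε : ℝ) (F : Set (Measure Ω)) (P : Measure Ω) : EReal :=
  -ENNReal.log (⨅ A ∈ {A : Ω → ℝ≥0∞ | IsTest A ∧ typeIError F A ≤ ENNReal.ofReal ε},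
    typeIIError P A)

/-- `HasSteinExponent F P e` says that the Stein exponent
`lim_{ε → 0⁺} liminf_{n → ∞} (1 / n) D_H^ε(F n ‖ P^{× n})` exists and equals `e`. -/
def HasSteinExponent {𝒵 : Type*} [MeasurableSpace 𝒵]
    (F : ∀ n : ℕ, Set (Measure (Fin n → 𝒵))) (P : Measure 𝒵) (e : EReal) : Prop :=
  Tendsto
    (fun ε : ℝ => liminf
      (fun n : ℕ => hypothesisTestingEntropy ε (F n) (Measure.pi fun _ : Fin n => P) / (n : EReal))
      atTop)
    (𝓝[>] 0) (𝓝 e)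

/-- The composite null hypothesis on `n` pairs: all laws `P_X^{× n} × Q_{Y^n}` of `(X^n, Y^n)` with
`Q_{Y^n}` an arbitrary probability measure on `𝒴^n`, read on `(𝒳 × 𝒴)^n ≃ 𝒳^n × 𝒴^n`. -/
def productHypotheses {𝒳 𝒴 : Type*} [MeasurableSpace 𝒳] [MeasurableSpace 𝒴]
    (PX : Measure 𝒳) (n : ℕ) : Set (Measure (Fin n → 𝒳 × 𝒴)) :=
  {R | ∃ Q : ProbabilityMeasure (Fin n → 𝒴),
    R = ((Measure.pi fun _ : Fin n => PX).prod (Q : Measure (Fin n → 𝒴))).map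
      (fun p i => (p.1 i, p.2 i))}

end

end Umlaut

/-!
The theorem holds for every joint law `P ≪ P_X × P_Y`, and a law with a Lebesgue density is of this
kind (`absolutelyContinuous_prod_marginals`). Let `W` be the density of `P` with respect to
`P_X × P_Y`, normalised so that `∫ W(x, y) dP_X(x) = 1` for every `y` (`exists_channel_density`).

*Converse.* For each `ν` the i.i.d. law `(P_X × ν)^{×n}` belongs to the null hypothesis, so the weak
converse of Stein's lemma (`mul_one_sub_le_of_exp_mul_typeIIError_le`) bounds the exponent at level
`ε` by `D(P_X × ν ‖ P) / (1 - ε)`. The factor disappears as `ε → 0`.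

*Achievability.* A composite null hypothesis with arbitrary `Q_{Y^n}` requires a type-I error that is
small conditionally on each `y^n`. For an order `t ∈ (0, 1]` let `h_t(y)` dominate
`(∫ W(x, y)^t dP_X(x))^{1/t}`. The test that guesses `H₀` when
`∏ W(x_i, y_i) ≤ ∏ exp(δ) h_t(y_i)` has conditional type-I error at most `exp(-t δ n)` by Markov's
inequality, whatever `y^n` is, and type-II error at most `(exp(δ) ∫ h_t dP_Y)^n` (`exists_test`).
No law of large numbers uniform in `y^n` is needed.

*Matching.* With `h_t(y) = exp(-∫ (W - 1 - (W^t - 1)/t) dP_X)`, monotone convergence gives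
`h_t(y) → h(y) = exp ∫ log W(x, y) dP_X(x)` as `t → 0`, and `∫ h_t dP_Y → Z = ∫ h dP_Y` since
`h_t ≤ 1` (`tendsto_lintegral_momentProxy`). If `Z > 0`, the output law `ν = (h / Z) P_Y` has
`D(P_X × ν ‖ P) = -log Z`, so that `U ≤ -log Z` (`umlautInformation_le`). Hence the rates
`-log ∫ h_t dP_Y` of the tests reach `U`, also when `Z = 0`.
-/

namespace Umlaut

/-! ### Product measures and densities -/

lemma lintegral_pi_prod {ι : Type*} [Fintype ι] {Z : ι → Type*} [∀ i, MeasurableSpace (Z i)]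
    (μ : ∀ i, Measure (Z i)) [∀ i, IsProbabilityMeasure (μ i)]
    {f : ∀ i, Z i → ℝ≥0∞} (hf : ∀ i, Measurable (f i)) :
    ∫⁻ z, ∏ i, f i (z i) ∂(Measure.pi μ) = ∏ i, ∫⁻ x, f i x ∂(μ i) := by
  have h := ProbabilityTheory.lintegral_prod_eq_prod_lintegral_of_indepFun (μ := Measure.pi μ)
    Finset.univ (fun i z => f i (z i))
    (ProbabilityTheory.iIndepFun_pi (fun i => (hf i).aemeasurable))
    (fun i => (hf i).comp (measurable_pi_apply i))
  rw [h]
  refine Finset.prod_congr rfl fun i _ => ?_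
  exact (measurePreserving_eval μ i).lintegral_comp (hf i)

lemma pi_withDensity {Z : Type*} [MeasurableSpace Z] (n : ℕ)
    (μ : Measure Z) [IsProbabilityMeasure μ] {f : Z → ℝ≥0∞} (hf : Measurable f)
    [IsProbabilityMeasure (μ.withDensity f)] :
    Measure.pi (fun _ : Fin n => μ.withDensity f) =
      (Measure.pi fun _ : Fin n => μ).withDensity fun z => ∏ i, f (z i) := by
  refine Measure.pi_eq (μ := fun _ : Fin n => μ.withDensity f) fun s hs => ?_
  rw [withDensity_apply _ (MeasurableSet.univ_pi hs),
    ← lintegral_indicator (MeasurableSet.univ_pi hs)]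
  have h : ∀ z : Fin n → Z, (Set.univ.pi s).indicator (fun z => ∏ i, f (z i)) z =
      ∏ i, (s i).indicator f (z i) := by
    intro z
    by_cases hz : z ∈ Set.univ.pi s
    · rw [Set.indicator_of_mem hz]
      exact Finset.prod_congr rfl fun i _ => (Set.indicator_of_mem (hz i trivial) f).symm
    · rw [Set.indicator_of_notMem hz]
      simp only [Set.mem_pi, Set.mem_univ, true_imp_iff, not_forall] at hz
      obtain ⟨i, hi⟩ := hz
      exact (Finset.prod_eq_zero (Finset.mem_univ i) (Set.indicator_of_notMem hi f)).symm
  simp_rw [h]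
  rw [lintegral_pi_prod _ fun i => hf.indicator (hs i)]
  refine Finset.prod_congr rfl fun i _ => ?_
  rw [lintegral_indicator (hs i), withDensity_apply _ (hs i)]

/-- The power of a product law, read on `(𝒳 × 𝒴)^n`, is the product of the powers. -/
lemma map_prod_pi_eq_pi_prod {X Y : Type*} [MeasurableSpace X] [MeasurableSpace Y] (n : ℕ)
    (μ : Measure X) (ν : Measure Y) [IsProbabilityMeasure μ] [IsProbabilityMeasure ν] :
    ((Measure.pi fun _ : Fin n => μ).prod (Measure.pi fun _ : Fin n => ν)).map
      (fun p i => (p.1 i, p.2 i)) = Measure.pi fun _ : Fin n => μ.prod ν :=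
  (MeasurePreserving.symm _ (measurePreserving_arrowProdEquivProdArrow X Y (Fin n)
    (fun _ => μ) (fun _ => ν))).map_eq

/-- A law on a product space that has a density with respect to some product measure has one with
respect to the product of its own marginals. -/
lemma absolutelyContinuous_prod_marginals {X Y : Type*} [MeasurableSpace X] [MeasurableSpace Y]
    {μ : Measure X} {ν : Measure Y} [SigmaFinite μ] [SigmaFinite ν]
    {P : Measure (X × Y)} [IsProbabilityMeasure P] (hP : P ≪ μ.prod ν) :
    P ≪ P.fst.prod P.snd := by
  have h1 : P.fst ≪ μ := by
    refine Measure.AbsolutelyContinuous.mk fun s hs h0 => ?_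
    rw [Measure.fst_apply hs]
    refine hP ?_
    rw [← Set.prod_univ, Measure.prod_prod, h0, zero_mul]
  have h2 : P.snd ≪ ν := by
    refine Measure.AbsolutelyContinuous.mk fun s hs h0 => ?_
    rw [Measure.snd_apply hs]
    refine hP ?_
    rw [← Set.univ_prod, Measure.prod_prod, h0, mul_zero]
  have hf := Measure.measurable_rnDeriv P.fst μ
  have hg := Measure.measurable_rnDeriv P.snd ν
  have e1 := Measure.withDensity_rnDeriv_eq _ _ h1
  have e2 := Measure.withDensity_rnDeriv_eq _ _ h2
  -- Almost surely under `P`, both marginal densities are positive.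
  have a1 : ∀ᵐ z ∂P, P.fst.rnDeriv μ z.1 ≠ 0 := by
    have : ∀ᵐ x ∂P.fst, P.fst.rnDeriv μ x ≠ 0 := by
      filter_upwards [Measure.rnDeriv_pos h1] with x hx using hx.ne'
    exact ae_of_ae_map measurable_fst.aemeasurable this
  have a2 : ∀ᵐ z ∂P, P.snd.rnDeriv ν z.2 ≠ 0 := by
    have : ∀ᵐ x ∂P.snd, P.snd.rnDeriv ν x ≠ 0 := by
      filter_upwards [Measure.rnDeriv_pos h2] with x hx using hx.ne'
    exact ae_of_ae_map measurable_snd.aemeasurable this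
  refine Measure.AbsolutelyContinuous.mk fun s hs h0 => ?_
  have e3 : P.fst.prod P.snd = (μ.prod ν).withDensity
      fun z => P.fst.rnDeriv μ z.1 * P.snd.rnDeriv ν z.2 := by
    rw [← prod_withDensity hf hg, e1, e2]
  rw [e3, withDensity_apply_eq_zero (by fun_prop)] at h0
  have h3 := hP h0
  rw [← nonpos_iff_eq_zero, ← h3]
  refine measure_mono_ae ?_
  filter_upwards [a1, a2] with z hz1 hz2 hz
  exact ⟨mul_ne_zero hz1 hz2, hz⟩

/-- A joint law that is absolutely continuous with respect to the product of its marginals has a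
density `W`, the channel `x ↦ P_{Y|X=x}` relative to `P_Y`. The density is chosen real-valued and
normalised in `x` for every `y`, not just for almost every one. -/
lemma exists_channel_density {X Y : Type*} [MeasurableSpace X] [MeasurableSpace Y]
    {P : Measure (X × Y)} [IsProbabilityMeasure P] (hP : P ≪ P.fst.prod P.snd) :
    ∃ W : X × Y → ℝ, Measurable W ∧ (∀ z, 0 ≤ W z) ∧
      (∀ y, ∫⁻ x, ENNReal.ofReal (W (x, y)) ∂P.fst = 1) ∧
      P = (P.fst.prod P.snd).withDensity fun z => ENNReal.ofReal (W z) := by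
  set V := P.rnDeriv (P.fst.prod P.snd) with hV
  have hVm : Measurable V := Measure.measurable_rnDeriv _ _
  have hVP : (P.fst.prod P.snd).withDensity V = P := Measure.withDensity_rnDeriv_eq _ _ hP
  have hIm : Measurable fun y => ∫⁻ x, V (x, y) ∂P.fst := hVm.lintegral_prod_left'
  have hI : (fun y => ∫⁻ x, V (x, y) ∂P.fst) =ᵐ[P.snd] fun _ => 1 := by
    refine ae_eq_of_forall_setLIntegral_eq_of_sigmaFinite hIm measurable_const fun s hs _ => ?_
    rw [setLIntegral_one, Measure.snd_apply hs]
    conv_rhs => rw [← hVP]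
    rw [withDensity_apply _ (measurable_snd hs), ← lintegral_indicator (measurable_snd hs),
      lintegral_prod_symm _ (hVm.indicator (measurable_snd hs)).aemeasurable,
      ← lintegral_indicator hs]
    refine lintegral_congr fun y => ?_
    by_cases hy : y ∈ s <;> simp [Set.indicator, hy]
  set S : Set Y := {y | ∫⁻ x, V (x, y) ∂P.fst = 1} with hS
  have hSm : MeasurableSet S := hIm (measurableSet_singleton 1)
  classical
  refine ⟨fun z => if z.2 ∈ S then (V z).toReal else 1, ?_, ?_, ?_, ?_⟩
  · exact Measurable.ite (measurable_snd hSm) hVm.ennreal_toReal measurable_const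
  · intro z
    dsimp only
    split_ifs <;> positivity
  · intro y
    by_cases hy : y ∈ S
    · simp only [hy, if_true]
      have hm : Measurable fun x => V (x, y) := hVm.comp measurable_prodMk_right
      have hfin : ∀ᵐ x ∂P.fst, V (x, y) < ∞ := by
        refine ae_lt_top hm ?_
        rw [show ∫⁻ x, V (x, y) ∂P.fst = 1 from hy]
        exact ENNReal.one_ne_top
      rw [← show ∫⁻ x, V (x, y) ∂P.fst = 1 from hy]
      refine lintegral_congr_ae ?_
      filter_upwards [hfin] with x hx using ENNReal.ofReal_toReal hx.ne
    · simp [hy]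
  · conv_lhs => rw [← hVP]
    refine withDensity_congr_ae ?_
    have hS' : ∀ᵐ z ∂P.fst.prod P.snd, z.2 ∈ S :=
      Measure.quasiMeasurePreserving_snd.ae hI
    filter_upwards [hS', Measure.rnDeriv_lt_top P (P.fst.prod P.snd)] with z hz hz'
    simp only [hz, if_true]
    exact (ENNReal.ofReal_toReal hz'.ne).symm

/-! ### The converse: no test beats the relative entropy -/

/-- The weak converse of Stein's lemma in exponential form: integrate `1 + u ≤ exp u` under `Q^{×n}`
for `u = l A - ∑ log (dR/dP)`, where the density turns `Q^{×n}` back into `P^{×n}`, and use that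
`exp (l A) ≤ 1 + A exp l` because `A` takes values in `[0, 1]`. -/
lemma mul_one_sub_le_of_exp_mul_typeIIError_le {Z : Type*} [MeasurableSpace Z]
    {Q P : Measure Z} [IsProbabilityMeasure Q] [IsProbabilityMeasure P]
    (hD : InformationTheory.klDiv Q P ≠ ∞) {n : ℕ} {A : (Fin n → Z) → ℝ≥0∞} (hA : IsTest A)
    {ε : ℝ} (hε : 0 ≤ ε)
    (h1 : ∫⁻ z, (1 - A z) ∂(Measure.pi fun _ : Fin n => Q) ≤ ENNReal.ofReal ε)
    {l : ℝ} (hl : 0 ≤ l)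
    (h2 : ENNReal.ofReal (Real.exp l) * typeIIError (Measure.pi fun _ : Fin n => P) A ≤ 1) :
    l * (1 - ε) ≤ n * (InformationTheory.klDiv Q P).toReal + 1 := by
  obtain ⟨hac, hint⟩ := InformationTheory.klDiv_ne_top_iff.1 hD
  have hDe : (InformationTheory.klDiv Q P).toReal = ∫ z, llr Q P z ∂Q :=
    InformationTheory.toReal_klDiv_of_measure_eq hac (by simp)
  set f : Z → ℝ≥0∞ := fun z => ENNReal.ofReal (Q.rnDeriv P z).toReal with hf
  have hfm : Measurable f := (Measure.measurable_rnDeriv Q P).ennreal_toReal.ennreal_ofReal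
  have hQf : Q = P.withDensity f := by
    conv_lhs => rw [← Measure.withDensity_rnDeriv_eq _ _ hac]
    refine withDensity_congr_ae ?_
    filter_upwards [Measure.rnDeriv_lt_top Q P] with z hz using (ENNReal.ofReal_toReal hz.ne).symm
  -- An inequality only: where `f` vanishes, `llr` is `log 0 = 0` and the left side is `0`.
  have hfl : ∀ z, f z * ENNReal.ofReal (Real.exp (-llr Q P z)) ≤ 1 := by
    intro z
    rw [hf, llr, ← ENNReal.ofReal_mul ENNReal.toReal_nonneg]
    refine ENNReal.ofReal_le_one.2 ?_
    rcases (ENNReal.toReal_nonneg (a := Q.rnDeriv P z)).eq_or_lt with h | h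
    · rw [← h]; simp
    · rw [Real.exp_neg, Real.exp_log h, mul_inv_cancel₀ h.ne']
  set a : (Fin n → Z) → ℝ := fun z => (A z).toReal with ha
  have ham : Measurable a := hA.measurable.ennreal_toReal
  have ha0 : ∀ z, 0 ≤ a z := fun z => ENNReal.toReal_nonneg
  have ha1 : ∀ z, a z ≤ 1 := fun z => ENNReal.toReal_le_of_le_ofReal zero_le_one
    (by simpa using hA.le_one z)
  have hAa : ∀ z, A z = ENNReal.ofReal (a z) := fun z =>
    (ENNReal.ofReal_toReal (ne_top_of_le_ne_top ENNReal.one_ne_top (hA.le_one z))).symm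
  set S : (Fin n → Z) → ℝ := fun z => ∑ i, llr Q P (z i) with hS
  have hSm : Measurable S := Finset.measurable_sum _ fun i _ =>
    (measurable_llr Q P).comp (measurable_pi_apply i)
  set Qn := Measure.pi fun _ : Fin n => Q with hQn
  have hSi : Integrable S Qn := integrable_finsetSum _ fun i _ =>
    integrable_comp_eval (μ := fun _ : Fin n => Q) hint
  have hSe : ∫ z, S z ∂Qn = n * (InformationTheory.klDiv Q P).toReal := by
    rw [hS, integral_finsetSum _ fun i _ =>
      integrable_comp_eval (μ := fun _ : Fin n => Q) hint, hDe]
    rw [Finset.sum_congr rfl fun i _ => integral_comp_eval (μ := fun _ : Fin n => Q) (i := i)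
      hint.aestronglyMeasurable]
    simp
  have hai : Integrable a Qn := Integrable.of_bound ham.aestronglyMeasurable 1
    (ae_of_all _ fun z => by rw [Real.norm_eq_abs, abs_of_nonneg (ha0 z)]; exact ha1 z)
  have hae : 1 - ε ≤ ∫ z, a z ∂Qn := by
    have h3 : ∫ z, (1 - a z) ∂Qn ≤ ε := by
      rw [integral_eq_lintegral_of_nonneg_ae (ae_of_all _ fun z => sub_nonneg.2 (ha1 z))
        (measurable_const.sub ham).aestronglyMeasurable]
      refine ENNReal.toReal_le_of_le_ofReal hε (le_trans (le_of_eq ?_) h1)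
      refine lintegral_congr fun z => ?_
      rw [hAa z, ENNReal.ofReal_sub _ (ha0 z), ENNReal.ofReal_one]
    rw [integral_sub (integrable_const _) hai] at h3
    simp only [integral_const, probReal_univ, smul_eq_mul, mul_one] at h3
    linarith
  set E : (Fin n → Z) → ℝ := fun z => Real.exp (l * a z - S z) with hE
  have hEm : Measurable E := ((ham.const_mul l).sub hSm).exp
  have hEl : ∫⁻ z, ENNReal.ofReal (E z) ∂Qn ≤ ENNReal.ofReal 2 := by
    have : IsProbabilityMeasure (P.withDensity f) := hQf ▸ inferInstance
    have hQn' : Qn = (Measure.pi fun _ : Fin n => P).withDensity fun z => ∏ i, f (z i) := by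
      rw [← pi_withDensity n P hfm, hQn]
      congr 1
      funext _
      exact hQf
    rw [hQn', lintegral_withDensity_eq_lintegral_mul _ (by fun_prop) hEm.ennreal_ofReal]
    calc ∫⁻ z, ((fun z : Fin n → Z => ∏ i, f (z i)) * fun z => ENNReal.ofReal (E z)) z
          ∂(Measure.pi fun _ : Fin n => P)
        ≤ ∫⁻ z, (1 + ENNReal.ofReal (Real.exp l) * A z) ∂(Measure.pi fun _ : Fin n => P) := by
          refine lintegral_mono fun z => ?_
          have hsplit : ENNReal.ofReal (E z) = ENNReal.ofReal (Real.exp (l * a z)) *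
              ∏ i, ENNReal.ofReal (Real.exp (-llr Q P (z i))) := by
            rw [← ENNReal.ofReal_prod_of_nonneg fun i _ => (Real.exp_pos _).le, ← Real.exp_sum,
              ← ENNReal.ofReal_mul (Real.exp_pos _).le, ← Real.exp_add, Finset.sum_neg_distrib,
              ← sub_eq_add_neg]
          have hexp : Real.exp (l * a z) ≤ 1 + Real.exp l * a z := by
            have := (convexOn_exp).2 (Set.mem_univ (0 : ℝ)) (Set.mem_univ l)
              (sub_nonneg.2 (ha1 z)) (ha0 z) (by ring)
            simp only [smul_eq_mul, mul_zero, zero_add, Real.exp_zero, mul_one] at this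
            rw [mul_comm l]
            nlinarith [ha0 z]
          rw [Pi.mul_apply]
          calc (∏ i, f (z i)) * ENNReal.ofReal (E z)
              = (∏ i, f (z i) * ENNReal.ofReal (Real.exp (-llr Q P (z i)))) *
                ENNReal.ofReal (Real.exp (l * a z)) := by
                rw [hsplit, Finset.prod_mul_distrib]; ring
            _ ≤ 1 * ENNReal.ofReal (Real.exp (l * a z)) := by
                gcongr
                exact Finset.prod_le_one' fun i _ => hfl (z i)
            _ ≤ ENNReal.ofReal (1 + Real.exp l * a z) := by
                rw [one_mul]; exact ENNReal.ofReal_le_ofReal hexp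
            _ = 1 + ENNReal.ofReal (Real.exp l) * A z := by
                rw [ENNReal.ofReal_add zero_le_one (mul_nonneg (Real.exp_pos _).le (ha0 z)),
                  ENNReal.ofReal_one, ENNReal.ofReal_mul (Real.exp_pos _).le, hAa z]
      _ ≤ ENNReal.ofReal 2 := by
          rw [lintegral_add_left measurable_const, lintegral_const_mul _ hA.measurable,
            lintegral_one, measure_univ]
          refine (add_le_add_right h2 1).trans (le_of_eq ?_)
          rw [one_add_one_eq_two]; simp
  have hEi : Integrable E Qn := by
    refine ⟨hEm.aestronglyMeasurable, ?_⟩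
    rw [hasFiniteIntegral_iff_ofReal (ae_of_all _ fun z => (Real.exp_pos _).le)]
    exact hEl.trans_lt ENNReal.ofReal_lt_top
  have hE2 : ∫ z, E z ∂Qn ≤ 2 := by
    rw [integral_eq_lintegral_of_nonneg_ae (ae_of_all _ fun z => (Real.exp_pos _).le)
      hEm.aestronglyMeasurable]
    exact ENNReal.toReal_le_of_le_ofReal zero_le_two hEl
  have hi : Integrable (fun z => l * a z - S z) Qn := (hai.const_mul l).sub hSi
  have hlow : ∫ z, (l * a z - S z + 1) ∂Qn ≤ ∫ z, E z ∂Qn :=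
    integral_mono (hi.add (integrable_const 1)) hEi fun z => Real.add_one_le_exp _
  rw [integral_add hi (integrable_const 1),
    integral_sub (hai.const_mul l) hSi, integral_const_mul, hSe] at hlow
  simp only [integral_const, probReal_univ, smul_eq_mul, mul_one] at hlow
  nlinarith [mul_le_mul_of_nonneg_left hae hl]

/-! ### The gap between `w - 1` and its Box–Cox approximations of `log w` -/

/-- The gap `w - 1 - (w ^ t - 1) / t`. It is nonnegative for `0 < t ≤ 1` and increases to
`w - 1 - log w` as `t` decreases to `0`, which turns limits of moments of order `t → 0` into
monotone convergence. -/
noncomputable def boxCoxGap (t w : ℝ) : ℝ := w - 1 - (w ^ t - 1) / t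

@[fun_prop]
lemma measurable_boxCoxGap (t : ℝ) : Measurable (boxCoxGap t) := by
  unfold boxCoxGap
  fun_prop

lemma boxCoxGap_anti {s t w : ℝ} (hs : 0 < s) (hst : s ≤ t) (hw : 0 ≤ w) :
    boxCoxGap t w ≤ boxCoxGap s w := by
  have ht : 0 < t := hs.trans_le hst
  -- Bernoulli's inequality for the exponent `s / t ≤ 1` at `w ^ t`.
  have hb := rpow_one_add_le_one_add_mul_self (s := w ^ t - 1) (p := s / t)
    (by linarith [Real.rpow_nonneg hw t]) (by positivity) ((div_le_one ht).2 hst)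
  rw [add_sub_cancel, ← Real.rpow_mul hw, mul_div_cancel₀ _ ht.ne'] at hb
  have : (w ^ s - 1) / s ≤ (w ^ t - 1) / t := by
    rw [div_le_div_iff₀ hs ht]
    have h2 : s / t * (w ^ t - 1) * t = s * (w ^ t - 1) := by field_simp
    nlinarith
  unfold boxCoxGap
  linarith

lemma boxCoxGap_nonneg {t w : ℝ} (ht : 0 < t) (ht1 : t ≤ 1) (hw : 0 ≤ w) : 0 ≤ boxCoxGap t w := by
  have h := boxCoxGap_anti ht ht1 hw
  have h1 : boxCoxGap 1 w = 0 := by simp [boxCoxGap]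
  linarith

/-- The limit of `boxCoxGap t w` as `t → 0⁺`: `w - 1 - log w` for `w > 0` and `∞` for `w = 0`. -/
noncomputable def logGap (w : ℝ) : ℝ≥0∞ :=
  ⨆ k : ℕ, ENNReal.ofReal (boxCoxGap (1 / ((k : ℝ) + 1)) w)

@[fun_prop]
lemma measurable_logGap : Measurable logGap :=
  Measurable.iSup fun _ => (measurable_boxCoxGap _).ennreal_ofReal

lemma monotone_boxCoxGap_one_div {w : ℝ} (hw : 0 ≤ w) :
    Monotone fun k : ℕ => ENNReal.ofReal (boxCoxGap (1 / ((k : ℝ) + 1)) w) :=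
  fun _ _ hjk => ENNReal.ofReal_le_ofReal
    (boxCoxGap_anti Nat.one_div_pos_of_nat (Nat.one_div_le_one_div hjk) hw)

lemma logGap_of_pos {w : ℝ} (hw : 0 < w) : logGap w = ENNReal.ofReal (w - 1 - Real.log w) := by
  refine tendsto_nhds_unique (tendsto_atTop_iSup (monotone_boxCoxGap_one_div hw.le)) ?_
  refine ENNReal.tendsto_ofReal (tendsto_const_nhds.sub ?_)
  have ht : Tendsto (fun k : ℕ => 1 / ((k : ℝ) + 1)) atTop (𝓝[>] 0) :=
    tendsto_nhdsWithin_iff.2 ⟨tendsto_one_div_add_atTop_nhds_zero_nat,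
      Eventually.of_forall fun k => Set.mem_Ioi.2 Nat.one_div_pos_of_nat⟩
  refine ((tendsto_rpow_sub_one_log hw).comp ht).congr fun k => ?_
  simp only [Function.comp]
  exact (div_eq_inv_mul _ _).symm

lemma logGap_zero : logGap 0 = ∞ := by
  rw [← ENNReal.iSup_natCast, logGap]
  refine iSup_congr fun k => ?_
  have hk : 1 / ((k : ℝ) + 1) ≠ 0 := Nat.one_div_pos_of_nat.ne'
  rw [boxCoxGap, Real.zero_rpow hk, ← ENNReal.ofReal_natCast]
  congr 1
  field_simp
  ring

/-- The moment bound behind the test: for a probability density `f`,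
`∫ f ^ t ≤ exp (-t ∫ boxCoxGap t f)`, from `∫ f ^ t = 1 - t ∫ boxCoxGap t f`. -/
lemma lintegral_rpow_le_exp {X : Type*} [MeasurableSpace X] {μ : Measure X}
    [IsProbabilityMeasure μ] {f : X → ℝ} (hf : Measurable f) (hf0 : ∀ x, 0 ≤ f x)
    (hf1 : ∫⁻ x, ENNReal.ofReal (f x) ∂μ = 1) {t : ℝ} (ht : 0 < t) (ht1 : t ≤ 1) :
    ∫⁻ x, ENNReal.ofReal (boxCoxGap t (f x)) ∂μ ≠ ∞ ∧
    ∫⁻ x, ENNReal.ofReal (f x ^ t) ∂μ ≤ ENNReal.ofReal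
      (Real.exp (-(t * (∫⁻ x, ENNReal.ofReal (boxCoxGap t (f x)) ∂μ).toReal))) := by
  have hfi : Integrable f μ := by
    refine ⟨hf.aestronglyMeasurable, ?_⟩
    rw [hasFiniteIntegral_iff_ofReal (ae_of_all _ hf0), hf1]
    exact ENNReal.one_lt_top
  have hfe : ∫ x, f x ∂μ = 1 := by
    rw [integral_eq_lintegral_of_nonneg_ae (ae_of_all _ hf0) hf.aestronglyMeasurable, hf1,
      ENNReal.toReal_one]
  have hpi : Integrable (fun x => f x ^ t) μ := by
    refine ((integrable_const (1 : ℝ)).add hfi).mono' (hf.pow_const t).aestronglyMeasurable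
      (ae_of_all _ fun x => ?_)
    rw [Real.norm_of_nonneg (Real.rpow_nonneg (hf0 x) t)]
    have := boxCoxGap_nonneg ht ht1 (hf0 x)
    have h2 : (f x ^ t - 1) / t ≤ f x - 1 := by unfold boxCoxGap at this; linarith
    rw [div_le_iff₀ ht] at h2
    simp only [Pi.add_apply]
    nlinarith [hf0 x]
  have hgi : Integrable (fun x => boxCoxGap t (f x)) μ :=
    (hfi.sub (integrable_const 1)).sub ((hpi.sub (integrable_const 1)).div_const t)
  have hg0 : ∀ x, 0 ≤ boxCoxGap t (f x) := fun x => boxCoxGap_nonneg ht ht1 (hf0 x)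
  have hge : ∫ x, boxCoxGap t (f x) ∂μ = -((∫ x, f x ^ t ∂μ - 1) / t) := by
    have e1 : Integrable (fun x => f x - 1) μ := hfi.sub (integrable_const 1)
    have e2 : Integrable (fun x => f x ^ t - 1) μ := hpi.sub (integrable_const 1)
    simp only [boxCoxGap]
    rw [integral_sub e1 (e2.div_const t), integral_div, integral_sub hfi (integrable_const 1),
      integral_sub hpi (integrable_const 1), hfe]
    simp
  rw [← ofReal_integral_eq_lintegral_ofReal hgi (ae_of_all _ hg0),
    ← ofReal_integral_eq_lintegral_ofReal hpi
      (ae_of_all _ fun x => Real.rpow_nonneg (hf0 x) t)]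
  refine ⟨ENNReal.ofReal_ne_top, ENNReal.ofReal_le_ofReal ?_⟩
  rw [ENNReal.toReal_ofReal (integral_nonneg hg0), hge]
  refine le_trans (le_of_eq ?_) (Real.add_one_le_exp _)
  field_simp
  ring

/-! ### Achievability: a likelihood-ratio test with a threshold depending on `y` -/

section Achievability

variable {X Y : Type*} [MeasurableSpace X] [MeasurableSpace Y]

/-- The upper bound `exp (-∫ boxCoxGap t (W (x, y)) dμ(x))` for the `L^t(μ)` norm of the density
`W (·, y)`; as `t → 0⁺` it decreases to the geometric mean `exp ∫ log W (x, y) dμ(x)`. -/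
noncomputable def momentProxy (μ : Measure X) (W : X × Y → ℝ) (t : ℝ) (y : Y) : ℝ≥0∞ :=
  ENNReal.ofReal (Real.exp (-(∫⁻ x, ENNReal.ofReal (boxCoxGap t (W (x, y))) ∂μ).toReal))

lemma measurable_momentProxy {μ : Measure X} [SFinite μ] {W : X × Y → ℝ} (hW : Measurable W)
    (t : ℝ) : Measurable (momentProxy μ W t) := by
  have : Measurable fun y => ∫⁻ x, ENNReal.ofReal (boxCoxGap t (W (x, y))) ∂μ :=
    Measurable.lintegral_prod_left' (f := fun z => ENNReal.ofReal (boxCoxGap t (W z)))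
      (by fun_prop)
  unfold momentProxy
  fun_prop

/-- The test guesses `H₀` when `∏ W (x_i, y_i) ≤ ∏ exp δ * momentProxy t y_i`. By Markov's
inequality for the `t`-th power, its type-I error is exponentially small given `y^n`, uniformly in
`y^n`. Hence it is small for every law `Q` of `Y^n`. -/
lemma exists_test {μ : Measure X} {ν : Measure Y} [IsProbabilityMeasure μ]
    [IsProbabilityMeasure ν] {W : X × Y → ℝ} (hW : Measurable W) (hW0 : ∀ z, 0 ≤ W z)
    (hW1 : ∀ y, ∫⁻ x, ENNReal.ofReal (W (x, y)) ∂μ = 1)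
    {P : Measure (X × Y)} [IsProbabilityMeasure P]
    (hP : P = (μ.prod ν).withDensity fun z => ENNReal.ofReal (W z))
    {t : ℝ} (ht : 0 < t) (ht1 : t ≤ 1) (δ : ℝ) (n : ℕ) :
    ∃ A : (Fin n → X × Y) → ℝ≥0∞, IsTest A ∧
      typeIError (productHypotheses μ n) A ≤ ENNReal.ofReal (Real.exp (-(t * δ))) ^ n ∧
      typeIIError (Measure.pi fun _ : Fin n => P) A ≤
        (ENNReal.ofReal (Real.exp δ) * ∫⁻ y, momentProxy μ W t y ∂ν) ^ n := by
  set c : Y → ℝ≥0∞ := fun y => ENNReal.ofReal (Real.exp δ) * momentProxy μ W t y with hc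
  have hcm : Measurable c := (measurable_momentProxy hW t).const_mul _
  have hc0 : ∀ y, c y ≠ 0 := fun y => by
    simp [hc, momentProxy, Real.exp_pos]
  have hct : ∀ y, c y ≠ ∞ := fun y => by
    simp only [hc, momentProxy]; finiteness
  set r : X × Y → ℝ≥0∞ := fun z => ENNReal.ofReal (W z) / c z.2 with hr
  have hrm : Measurable r := by fun_prop
  have hrt : ∀ z, r z ≠ ∞ := fun z => ENNReal.div_ne_top ENNReal.ofReal_ne_top (hc0 _)
  set T : Set (Fin n → X × Y) := {z | ∏ i, r (z i) ≤ 1} with hT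
  have hTm : MeasurableSet T := measurableSet_le
    (Finset.measurable_prod _ fun i _ => hrm.comp (measurable_pi_apply i)) measurable_const
  refine ⟨T.indicator 1, ⟨measurable_one.indicator hTm, fun z => ?_⟩, ?_, ?_⟩
  · exact Set.indicator_le_self' (fun _ _ => zero_le) z
  · refine iSup₂_le fun R hR => ?_
    obtain ⟨Q, rfl⟩ := hR
    have hgm : Measurable fun p : (Fin n → X) × (Fin n → Y) => fun i => (p.1 i, p.2 i) := by
      fun_prop
    have hbound : ∀ z : Fin n → X × Y,
        1 - T.indicator (1 : (Fin n → X × Y) → ℝ≥0∞) z ≤ ∏ i, r (z i) ^ t := by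
      intro z
      by_cases hz : z ∈ T
      · simp [hz]
      · rw [Set.indicator_of_notMem hz, tsub_zero, ENNReal.prod_rpow_of_nonneg ht.le]
        exact ENNReal.one_le_rpow (le_of_not_ge hz) ht
    have hy : ∀ y, ∫⁻ x, r (x, y) ^ t ∂μ ≤ ENNReal.ofReal (Real.exp (-(t * δ))) := by
      intro y
      have hWy : Measurable fun x => W (x, y) := hW.comp measurable_prodMk_right
      obtain ⟨-, hm⟩ := lintegral_rpow_le_exp hWy (fun x => hW0 _) (hW1 y) ht ht1
      have : ∀ x, r (x, y) ^ t = ENNReal.ofReal (W (x, y) ^ t) * (c y ^ t)⁻¹ := by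
        intro x
        rw [hr, ENNReal.div_rpow_of_nonneg _ _ ht.le, div_eq_mul_inv,
          ENNReal.ofReal_rpow_of_nonneg (hW0 _) ht.le]
      simp_rw [this]
      rw [lintegral_mul_const _ (by fun_prop)]
      refine (mul_le_mul_left hm _).trans (le_of_eq ?_)
      simp only [hc, momentProxy]
      rw [← ENNReal.ofReal_mul (Real.exp_pos _).le, ← Real.exp_add,
        ENNReal.ofReal_rpow_of_nonneg (Real.exp_pos _).le ht.le,
        ← ENNReal.ofReal_inv_of_pos (by positivity), ← ENNReal.ofReal_mul (Real.exp_pos _).le,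
        ← Real.exp_mul, ← Real.exp_neg, ← Real.exp_add]
      congr 2
      ring
    calc ∫⁻ z, (1 - T.indicator 1 z) ∂(((Measure.pi fun _ : Fin n => μ).prod
          (Q : Measure (Fin n → Y))).map fun p i => (p.1 i, p.2 i))
        ≤ ∫⁻ z, ∏ i, r (z i) ^ t ∂(((Measure.pi fun _ : Fin n => μ).prod
          (Q : Measure (Fin n → Y))).map fun p i => (p.1 i, p.2 i)) := lintegral_mono hbound
      _ = ∫⁻ y, ∫⁻ x, ∏ i, r (x i, y i) ^ t ∂(Measure.pi fun _ : Fin n => μ)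
          ∂(Q : Measure (Fin n → Y)) := by
        rw [lintegral_map (by fun_prop) hgm, lintegral_prod_symm _ (by fun_prop)]
      _ ≤ ∫⁻ y, ENNReal.ofReal (Real.exp (-(t * δ))) ^ n ∂(Q : Measure (Fin n → Y)) := by
        refine lintegral_mono fun y => ?_
        rw [lintegral_pi_prod (fun _ : Fin n => μ) (f := fun i x => r (x, y i) ^ t)
          (fun i => by fun_prop)]
        refine (Finset.prod_le_pow_card _ _ _ fun i _ => hy (y i)).trans (by simp)
      _ = ENNReal.ofReal (Real.exp (-(t * δ))) ^ n := by simp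
  · have hbound : ∀ z : Fin n → X × Y,
        T.indicator (1 : (Fin n → X × Y) → ℝ≥0∞) z ≤ ∏ i, (r (z i))⁻¹ := by
      intro z
      by_cases hz : z ∈ T
      · rw [Set.indicator_of_mem hz, Pi.one_apply,
          ← ENNReal.prod_inv_distrib (fun i _ j _ _ => Or.inr (hrt _))]
        exact ENNReal.one_le_inv.2 hz
      · simp [hz]
    have h1 : ∫⁻ z, (r z)⁻¹ ∂P ≤ ∫⁻ y, c y ∂ν := by
      rw [hP, lintegral_withDensity_eq_lintegral_mul _ (by fun_prop) (by fun_prop)]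
      calc ∫⁻ z, ((fun z => ENNReal.ofReal (W z)) * fun z => (r z)⁻¹) z ∂(μ.prod ν)
          ≤ ∫⁻ z, c z.2 ∂(μ.prod ν) := by
            refine lintegral_mono fun z => ?_
            simp only [Pi.mul_apply, hr]
            rw [ENNReal.inv_div (Or.inl (hct _)) (Or.inl (hc0 _))]
            exact ENNReal.mul_div_le
        _ = ∫⁻ y, c y ∂ν := by
            rw [lintegral_prod_symm _ (by fun_prop)]
            simp
    rw [hc, lintegral_const_mul _ (measurable_momentProxy hW t)] at h1
    calc typeIIError (Measure.pi fun _ : Fin n => P) (T.indicator 1)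
        ≤ ∫⁻ z, ∏ i, (r (z i))⁻¹ ∂(Measure.pi fun _ : Fin n => P) := lintegral_mono hbound
      _ = ∏ _i : Fin n, ∫⁻ z, (r z)⁻¹ ∂P :=
        lintegral_pi_prod (fun _ : Fin n => P) fun _ => hrm.inv
      _ ≤ _ := (Finset.prod_le_pow_card _ _ _ fun i _ => h1).trans (by simp)

end Achievability

/-! ### The optimal output law -/

section OptimalLaw

variable {X Y : Type*} [MeasurableSpace X]

/-- The integral of `W - 1 - log W` in the first variable, so that for `∫ W (x, y) dμ(x) = 1` it
is `-∫ log W (x, y) dμ(x)`; it is `∞` when this integral diverges. -/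
noncomputable def meanLogGap (μ : Measure X) (W : X × Y → ℝ) (y : Y) : ℝ≥0∞ :=
  ∫⁻ x, logGap (W (x, y)) ∂μ

/-- The geometric mean `exp ∫ log W (x, y) dμ(x)` of the density, with value `0` when the integral
is `-∞`. -/
noncomputable def geomMean (μ : Measure X) (W : X × Y → ℝ) (y : Y) : ℝ≥0∞ :=
  EReal.exp (-(meanLogGap μ W y : EReal))

lemma geomMean_le_one (μ : Measure X) (W : X × Y → ℝ) (y : Y) : geomMean μ W y ≤ 1 := by
  rw [geomMean, EReal.exp_le_one_iff, EReal.neg_le, neg_zero]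
  exact EReal.coe_ennreal_nonneg _

lemma geomMean_of_ne_top {μ : Measure X} {W : X × Y → ℝ} {y : Y} (h : meanLogGap μ W y ≠ ∞) :
    geomMean μ W y = ENNReal.ofReal (Real.exp (-(meanLogGap μ W y).toReal)) := by
  rw [geomMean, ← EReal.exp_coe, EReal.coe_neg, EReal.coe_ennreal_toReal h]

lemma geomMean_of_eq_top {μ : Measure X} {W : X × Y → ℝ} {y : Y} (h : meanLogGap μ W y = ∞) :
    geomMean μ W y = 0 := by
  simp [geomMean, h]

lemma geomMean_mul_meanLogGap_le_one (μ : Measure X) (W : X × Y → ℝ) (y : Y) :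
    geomMean μ W y * meanLogGap μ W y ≤ 1 := by
  by_cases h : meanLogGap μ W y = ∞
  · simp [geomMean_of_eq_top h]
  · rw [geomMean_of_ne_top h]
    conv_lhs => rw [← ENNReal.ofReal_toReal h]
    rw [← ENNReal.ofReal_mul (Real.exp_pos _).le, ENNReal.toReal_ofReal ENNReal.toReal_nonneg,
      ENNReal.ofReal_le_one, Real.exp_neg, inv_mul_le_iff₀ (Real.exp_pos _), mul_one]
    linarith [Real.add_one_le_exp (meanLogGap μ W y).toReal]

variable [MeasurableSpace Y]

lemma measurable_meanLogGap {μ : Measure X} [SFinite μ] {W : X × Y → ℝ} (hW : Measurable W) :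
    Measurable (meanLogGap μ W) :=
  Measurable.lintegral_prod_left' (f := fun z => logGap (W z)) (by fun_prop)

lemma measurable_geomMean {μ : Measure X} [SFinite μ] {W : X × Y → ℝ} (hW : Measurable W) :
    Measurable (geomMean μ W) :=
  (measurable_meanLogGap hW).coe_ereal_ennreal.neg.ereal_exp

/-- The moment proxies of order `1 / (k + 1)` converge in mean to the geometric mean. -/
lemma tendsto_lintegral_momentProxy {μ : Measure X} {ν : Measure Y} [IsProbabilityMeasure μ]
    [IsProbabilityMeasure ν] {W : X × Y → ℝ} (hW : Measurable W) (hW0 : ∀ z, 0 ≤ W z)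
    (hW1 : ∀ y, ∫⁻ x, ENNReal.ofReal (W (x, y)) ∂μ = 1) :
    Tendsto (fun k : ℕ => ∫⁻ y, momentProxy μ W (1 / ((k : ℝ) + 1)) y ∂ν) atTop
      (𝓝 (∫⁻ y, geomMean μ W y ∂ν)) := by
  have hpos : ∀ k : ℕ, 0 < 1 / ((k : ℝ) + 1) := fun k => Nat.one_div_pos_of_nat
  have hle : ∀ k : ℕ, 1 / ((k : ℝ) + 1) ≤ 1 := fun k => by
    simpa using Nat.one_div_le_one_div (α := ℝ) (Nat.zero_le k)
  refine tendsto_lintegral_of_dominated_convergence (fun _ => 1)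
    (fun k => measurable_momentProxy hW _) (fun k => ae_of_all _ fun y => ?_) (by simp)
    (ae_of_all _ fun y => ?_)
  · rw [momentProxy, ENNReal.ofReal_le_one, Real.exp_le_one_iff, neg_nonpos]
    exact ENNReal.toReal_nonneg
  · have hWy : Measurable fun x => W (x, y) := hW.comp measurable_prodMk_right
    have hlim : Tendsto (fun k : ℕ => ∫⁻ x, ENNReal.ofReal
        (boxCoxGap (1 / ((k : ℝ) + 1)) (W (x, y))) ∂μ) atTop (𝓝 (meanLogGap μ W y)) := by
      have hmono : Monotone fun (k : ℕ) x => ENNReal.ofReal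
          (boxCoxGap (1 / ((k : ℝ) + 1)) (W (x, y))) :=
        fun j k hjk x => monotone_boxCoxGap_one_div (hW0 _) hjk
      rw [meanLogGap]
      simp only [logGap]
      rw [lintegral_iSup (fun k => by fun_prop) hmono]
      exact tendsto_atTop_iSup fun j k hjk => lintegral_mono (hmono hjk)
    have heq : ∀ k : ℕ, momentProxy μ W (1 / ((k : ℝ) + 1)) y =
        EReal.exp (-((∫⁻ x, ENNReal.ofReal (boxCoxGap (1 / ((k : ℝ) + 1)) (W (x, y))) ∂μ :
          ℝ≥0∞) : EReal)) := by
      intro k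
      obtain ⟨hfin, -⟩ := lintegral_rpow_le_exp hWy (fun x => hW0 _) (hW1 y) (hpos k) (hle k)
      rw [momentProxy, ← EReal.exp_coe, EReal.coe_neg, EReal.coe_ennreal_toReal hfin]
    simp_rw [heq]
    exact (ENNReal.continuous_exp.tendsto _).comp ((continuous_neg.tendsto _).comp
      ((continuous_coe_ennreal_ereal.tendsto _).comp hlim))

/-- The law with `ν`-density proportional to the geometric mean `exp ∫ log W (x, ·) dμ(x)` makes
the relative entropy in the umlaut information equal to minus the logarithm of the normalisation. -/
lemma umlautInformation_le {P : Measure (X × Y)} [IsProbabilityMeasure P] {ν : Measure Y}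
    [IsProbabilityMeasure ν] {W : X × Y → ℝ} (hW : Measurable W) (hW0 : ∀ z, 0 ≤ W z)
    (hW1 : ∀ y, ∫⁻ x, ENNReal.ofReal (W (x, y)) ∂P.fst = 1)
    (hP : P = (P.fst.prod ν).withDensity fun z => ENNReal.ofReal (W z))
    (hZ : ∫⁻ y, geomMean P.fst W y ∂ν ≠ 0) :
    umlautInformation P ≤
      ENNReal.ofReal (-Real.log (∫⁻ y, geomMean P.fst W y ∂ν).toReal) := by
  set μ := P.fst with hμ
  set h := geomMean μ W with hh
  set H := meanLogGap μ W with hH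
  set Z := ∫⁻ y, h y ∂ν
  have hhm : Measurable h := measurable_geomMean hW
  have hHm : Measurable H := measurable_meanLogGap hW
  have hZt : Z ≠ ∞ := by
    refine ((lintegral_mono (geomMean_le_one μ W)).trans_lt ?_).ne
    simp
  set q : Y → ℝ≥0∞ := fun y => h y / Z with hq
  have hqm : Measurable q := hhm.div_const Z
  have hqint : ∫⁻ y, q y ∂ν = 1 := by
    simp only [hq, div_eq_mul_inv]
    rw [lintegral_mul_const _ hhm, ENNReal.mul_inv_cancel hZ hZt]
  set ν' := ν.withDensity q with hν'
  have hν'p : IsProbabilityMeasure ν' := ⟨by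
    rw [hν', withDensity_apply _ MeasurableSet.univ, setLIntegral_univ, hqint]⟩
  set Q := μ.prod ν' with hQ
  have hQd : Q = (μ.prod ν).withDensity fun z => q z.2 := prod_withDensity_right hqm
  have hHint : ∫⁻ z, H z.2 ∂Q ≠ ∞ := by
    rw [hQd, lintegral_withDensity_eq_lintegral_mul _ (by fun_prop) (by fun_prop)]
    refine ((lintegral_mono fun z => ?_).trans_lt (lintegral_const_lt_top (c := Z⁻¹) ?_)).ne
    · simp only [Pi.mul_apply, hq, div_eq_mul_inv]
      rw [mul_right_comm]
      exact (mul_le_mul_left (geomMean_mul_meanLogGap_le_one μ W z.2) _).trans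
        (one_mul _).le
    · exact ENNReal.inv_ne_top.2 hZ
  have hKint : ∫⁻ z, logGap (W z) ∂Q = ∫⁻ z, H z.2 ∂Q := by
    rw [hQ, lintegral_prod_symm _ (by fun_prop), lintegral_prod_symm _ (by fun_prop)]
    refine lintegral_congr fun y => ?_
    simp [hH, meanLogGap]
  have hWint : ∫⁻ z, ENNReal.ofReal (W z) ∂Q = 1 := by
    rw [hQ, lintegral_prod_symm _ (by fun_prop)]
    simp [hW1]
  have hWpos : ∀ᵐ z ∂Q, 0 < W z := by
    filter_upwards [ae_lt_top (by fun_prop) (hKint ▸ hHint)] with z hz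
    refine (hW0 z).lt_of_ne fun h0 => ?_
    rw [← h0, logGap_zero] at hz
    exact lt_irrefl _ hz
  -- The density of `Q` with respect to `P`; its values where `W = 0` do not matter, since `Q`-almost
  -- surely `W > 0`.
  set φ : X × Y → ℝ≥0∞ := fun z => q z.2 / ENNReal.ofReal (W z) with hφ
  have hφm : Measurable φ := by fun_prop
  have hQφ : Q = P.withDensity φ := by
    conv_rhs => rw [hP]
    rw [← withDensity_mul _ (by fun_prop) hφm, hQd]
    refine withDensity_congr_ae ?_
    rw [hQd, ae_withDensity_iff (by fun_prop)] at hWpos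
    filter_upwards [hWpos] with z hz
    simp only [Pi.mul_apply, hφ]
    by_cases hqz : q z.2 = 0
    · simp [hqz]
    · rw [ENNReal.mul_div_cancel (by simpa using hz hqz) ENNReal.ofReal_ne_top]
  have hac : Q ≪ P := hQφ ▸ withDensity_absolutelyContinuous P φ
  have hderiv : Q.rnDeriv P =ᵐ[Q] φ := by
    have hd := Measure.rnDeriv_withDensity P hφm
    rw [← hQφ] at hd
    exact hac.ae_le hd
  set F : X × Y → ℝ := fun z =>
    -(H z.2).toReal - Real.log Z.toReal - (W z - 1 - (logGap (W z)).toReal) with hF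
  have hllr : llr Q P =ᵐ[Q] F := by
    filter_upwards [hderiv, hWpos, ae_lt_top (by fun_prop) hHint] with z h1 h2 h3
    have hZ0 : 0 < Z.toReal := ENNReal.toReal_pos hZ hZt
    have hg : 0 ≤ W z - 1 - Real.log (W z) := by linarith [Real.log_le_sub_one_of_pos h2]
    rw [llr, h1, hF]
    simp only [hφ, hq, hh, geomMean_of_ne_top h3.ne, logGap_of_pos h2, ENNReal.toReal_div,
      ENNReal.toReal_ofReal (Real.exp_pos _).le, ENNReal.toReal_ofReal h2.le,
      ENNReal.toReal_ofReal hg]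
    rw [Real.log_div (by positivity) h2.ne', Real.log_div (by positivity) hZ0.ne', Real.log_exp]
    ring
  have i1 : Integrable (fun z : X × Y => (H z.2).toReal) Q :=
    integrable_toReal_of_lintegral_ne_top (by fun_prop) hHint
  have i2 : Integrable (fun z : X × Y => (logGap (W z)).toReal) Q :=
    integrable_toReal_of_lintegral_ne_top (by fun_prop) (hKint ▸ hHint)
  have i3 : Integrable W Q := by
    refine ⟨hW.aestronglyMeasurable, ?_⟩
    rw [hasFiniteIntegral_iff_ofReal (ae_of_all _ hW0), hWint]
    exact ENNReal.one_lt_top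
  have i1' : Integrable (fun z : X × Y => -(H z.2).toReal) Q := i1.neg
  have i4 : Integrable (fun z : X × Y => -(H z.2).toReal - Real.log Z.toReal) Q :=
    i1'.sub (integrable_const _)
  have i5 : Integrable (fun z : X × Y => W z - 1) Q := i3.sub (integrable_const _)
  have i6 : Integrable (fun z : X × Y => W z - 1 - (logGap (W z)).toReal) Q := i5.sub i2
  have e12 : ∫ z, (logGap (W z)).toReal ∂Q = ∫ z, (H z.2).toReal ∂Q := by
    rw [integral_toReal (by fun_prop) (ae_lt_top (by fun_prop) (hKint ▸ hHint)),
      integral_toReal (by fun_prop) (ae_lt_top (by fun_prop) hHint), hKint]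
  have e3 : ∫ z, W z ∂Q = 1 := by
    rw [integral_eq_lintegral_of_nonneg_ae (ae_of_all _ hW0) hW.aestronglyMeasurable, hWint,
      ENNReal.toReal_one]
  have hFe : ∫ z, F z ∂Q = -Real.log Z.toReal := by
    simp only [hF]
    rw [integral_sub i4 i6, integral_sub i1' (integrable_const _), integral_sub i5 i2,
      integral_sub i3 (integrable_const _), integral_neg, e12, e3]
    simp only [integral_const, probReal_univ, one_smul]
    ring
  have hkl : InformationTheory.klDiv Q P = ENNReal.ofReal (-Real.log Z.toReal) := by
    rw [InformationTheory.klDiv_of_ac_of_integrable hac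
      (((i4.sub i6).congr (ae_of_all _ fun _ => rfl)).congr hllr.symm),
      integral_congr_ae hllr, hFe]
    simp
  exact (iInf_le _ (⟨ν', hν'p⟩ : ProbabilityMeasure Y)).trans hkl.le

end OptimalLaw

/-! ### The two bounds on the exponent -/

section Exponent

variable {X Y : Type*} [MeasurableSpace X] [MeasurableSpace Y]

/-- Achievability: every `b < U` is a rate. If `Z = ∫ exp (∫ log W dP_X) dP_Y` satisfied
`Z ≥ exp (-b)`, the optimal output law would give `U ≤ -log Z ≤ b`; hence `Z < exp (-b)`, and the
test of a sufficiently small order `t` has type-II error at most `exp (-b n)`. -/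
lemma le_liminf_of_lt_umlautInformation {P : Measure (X × Y)} [IsProbabilityMeasure P]
    (hP : P ≪ P.fst.prod P.snd) {b : ℝ} (hb : (b : EReal) < (umlautInformation P : EReal))
    {ε : ℝ} (hε : 0 < ε) :
    (b : EReal) ≤ liminf (fun n : ℕ => hypothesisTestingEntropy ε (productHypotheses P.fst n)
      (Measure.pi fun _ : Fin n => P) / (n : EReal)) atTop := by
  obtain ⟨W, hW, hW0, hW1, hPW⟩ := exists_channel_density hP
  have hlt : ∫⁻ y, geomMean P.fst W y ∂P.snd < ENNReal.ofReal (Real.exp (-b)) := by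
    by_contra! hle
    have hpos : 0 < ∫⁻ y, geomMean P.fst W y ∂P.snd :=
      (ENNReal.ofReal_pos.2 (Real.exp_pos _)).trans_le hle
    have hfin : ∫⁻ y, geomMean P.fst W y ∂P.snd ≠ ∞ :=
      ((lintegral_mono (geomMean_le_one P.fst W)).trans_lt (by simp)).ne
    have hone : (∫⁻ y, geomMean P.fst W y ∂P.snd).toReal ≤ 1 := by
      refine ENNReal.toReal_le_of_le_ofReal zero_le_one ?_
      exact (lintegral_mono (geomMean_le_one P.fst W)).trans (by simp)
    have hU := umlautInformation_le hW hW0 hW1 hPW hpos.ne'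
    have hlog : -Real.log (∫⁻ y, geomMean P.fst W y ∂P.snd).toReal ≤ b := by
      rw [neg_le, Real.le_log_iff_exp_le (ENNReal.toReal_pos hpos.ne' hfin)]
      exact (ENNReal.ofReal_le_iff_le_toReal hfin).1 hle
    refine hb.not_ge ((EReal.coe_ennreal_le_coe_ennreal_iff.2 hU).trans ?_)
    rw [EReal.coe_ennreal_ofReal, EReal.coe_le_coe_iff]
    refine max_le hlog (le_trans ?_ hlog)
    exact neg_nonneg.2 (Real.log_nonpos ENNReal.toReal_nonneg hone)
  obtain ⟨k, hk⟩ := ((tendsto_lintegral_momentProxy (ν := P.snd) hW hW0 hW1).eventually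
    (gt_mem_nhds hlt)).exists
  set t : ℝ := 1 / ((k : ℝ) + 1) with ht
  have ht0 : 0 < t := Nat.one_div_pos_of_nat
  have ht1 : t ≤ 1 := by
    rw [ht]
    simpa using Nat.one_div_le_one_div (α := ℝ) (Nat.zero_le k)
  -- The strict inequality leaves room for a positive margin `δ` in the threshold of the test.
  obtain ⟨δ, hδ0, hδ⟩ : ∃ δ : ℝ, 0 < δ ∧ ENNReal.ofReal (Real.exp δ) *
      ∫⁻ y, momentProxy P.fst W t y ∂P.snd ≤ ENNReal.ofReal (Real.exp (-b)) := by
    set z := ∫⁻ y, momentProxy P.fst W t y ∂P.snd with hz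
    have hzt : z ≠ ∞ := hk.ne_top
    have hzr : z.toReal < Real.exp (-b) := (ENNReal.lt_ofReal_iff_toReal_lt hzt).1 hk
    have hlim : Tendsto (fun δ : ℝ => Real.exp δ * z.toReal) (𝓝[>] 0) (𝓝 z.toReal) := by
      have hc : Continuous fun δ : ℝ => Real.exp δ * z.toReal := by fun_prop
      simpa using (hc.tendsto 0).mono_left nhdsWithin_le_nhds
    obtain ⟨δ, hδ, hδ0⟩ := ((hlim.eventually (gt_mem_nhds hzr)).and self_mem_nhdsWithin).exists
    refine ⟨δ, hδ0, ?_⟩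
    rw [← ENNReal.ofReal_toReal hzt, ← ENNReal.ofReal_mul (Real.exp_pos _).le]
    exact ENNReal.ofReal_le_ofReal hδ.le
  have hI : Tendsto (fun n : ℕ => ENNReal.ofReal (Real.exp (-(t * δ))) ^ n) atTop (𝓝 0) := by
    refine ENNReal.tendsto_pow_atTop_nhds_zero_of_lt_one ?_
    rw [ENNReal.ofReal_lt_one, Real.exp_lt_one_iff]
    exact neg_neg_of_pos (mul_pos ht0 hδ0)
  refine le_liminf_of_le (by isBoundedDefault) ?_
  filter_upwards [hI.eventually (ge_mem_nhds (ENNReal.ofReal_pos.2 hε)), eventually_gt_atTop 0]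
    with n hn hn0
  obtain ⟨A, hA, hA1, hA2⟩ := exists_test hW hW0 hW1 hPW ht0 ht1 δ n
  have hn0' : (0 : EReal) < (n : EReal) := by exact_mod_cast hn0
  rw [EReal.le_div_iff_mul_le hn0' (EReal.natCast_ne_top n), hypothesisTestingEntropy,
    EReal.le_neg]
  calc ENNReal.log _ ≤ ENNReal.log (ENNReal.ofReal (Real.exp (-b)) ^ n) := by
        refine ENNReal.log_le_log (iInf₂_le_of_le A ⟨hA, hA1.trans hn⟩ (hA2.trans ?_))
        gcongr
    _ = -((b : EReal) * n) := by
        rw [ENNReal.log_pow, ENNReal.log_ofReal_of_pos (Real.exp_pos _), Real.log_exp, mul_comm,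
          EReal.coe_neg, EReal.neg_mul]

/-- The converse for `n` samples: the i.i.d. hypothesis `(P_X × ν)^{×n}` belongs to the composite
null hypothesis. -/
lemma hypothesisTestingEntropy_le {P : Measure (X × Y)} [IsProbabilityMeasure P]
    {ν : Measure Y} [IsProbabilityMeasure ν]
    (hD : InformationTheory.klDiv (P.fst.prod ν) P ≠ ∞) {ε : ℝ} (hε : 0 < ε) (hε1 : ε < 1)
    (n : ℕ) :
    hypothesisTestingEntropy ε (productHypotheses P.fst n) (Measure.pi fun _ : Fin n => P) ≤
      (((n * (InformationTheory.klDiv (P.fst.prod ν) P).toReal + 1) / (1 - ε) : ℝ) : EReal) := by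
  set M := (n * (InformationTheory.klDiv (P.fst.prod ν) P).toReal + 1) / (1 - ε) with hM
  have hM0 : 0 ≤ M := by
    have : 0 < 1 - ε := by linarith
    positivity
  rw [hypothesisTestingEntropy, EReal.neg_le, ← EReal.coe_neg, ← Real.log_exp (-M),
    ← ENNReal.log_ofReal_of_pos (Real.exp_pos _)]
  refine ENNReal.log_le_log (le_iInf₂ fun A hA => ?_)
  by_contra! hlt
  -- If the type-II error were below `exp (-M)`, the converse would hold with some `l > M`.
  obtain ⟨r, hr1, hr2⟩ := ENNReal.lt_iff_exists_nnreal_btwn.1 hlt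
  have hr0 : 0 < (r : ℝ) := by
    have : (0 : ℝ≥0∞) < r := zero_le.trans_lt hr1
    exact_mod_cast this
  have hrM : (r : ℝ) < Real.exp (-M) := by
    have := (ENNReal.lt_ofReal_iff_toReal_lt ENNReal.coe_ne_top).1 hr2
    simpa using this
  have hl : M < -Real.log r := by
    rw [lt_neg, Real.log_lt_iff_lt_exp hr0]
    exact hrM
  have hconv := mul_one_sub_le_of_exp_mul_typeIIError_le hD hA.1 hε.le ?_
    (hM0.trans hl.le) ?_
  · rw [← le_div_iff₀ (by linarith)] at hconv
    exact absurd hconv (not_le.2 hl)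
  · refine le_trans ?_ hA.2
    refine le_iSup₂_of_le (f := fun Q _ => ∫⁻ ω, (1 - A ω) ∂Q)
      (Measure.pi fun _ : Fin n => P.fst.prod ν) ?_ le_rfl
    exact ⟨⟨Measure.pi fun _ : Fin n => ν, inferInstance⟩, (map_prod_pi_eq_pi_prod n _ _).symm⟩
  · rw [Real.exp_neg, Real.exp_log hr0]
    calc ENNReal.ofReal ((r : ℝ)⁻¹) * typeIIError (Measure.pi fun _ : Fin n => P) A
        ≤ ENNReal.ofReal ((r : ℝ)⁻¹) * r := by gcongr
      _ = 1 := by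
        rw [← ENNReal.ofReal_coe_nnreal, ← ENNReal.ofReal_mul (by positivity),
          inv_mul_cancel₀ hr0.ne', ENNReal.ofReal_one]

lemma liminf_le_of_klDiv {P : Measure (X × Y)} [IsProbabilityMeasure P]
    {ν : Measure Y} [IsProbabilityMeasure ν]
    (hD : InformationTheory.klDiv (P.fst.prod ν) P ≠ ∞) {ε : ℝ} (hε : 0 < ε) (hε1 : ε < 1) :
    liminf (fun n : ℕ => hypothesisTestingEntropy ε (productHypotheses P.fst n)
      (Measure.pi fun _ : Fin n => P) / (n : EReal)) atTop ≤
      (((InformationTheory.klDiv (P.fst.prod ν) P).toReal / (1 - ε) : ℝ) : EReal) := by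
  set D := (InformationTheory.klDiv (P.fst.prod ν) P).toReal with hDdef
  have hlim : Tendsto (fun n : ℕ => (((D + 1 / (n : ℝ)) / (1 - ε) : ℝ) : EReal)) atTop
      (𝓝 ((D / (1 - ε) : ℝ) : EReal)) := by
    refine (continuous_coe_real_ereal.tendsto _).comp (Tendsto.div_const ?_ _)
    simpa using (tendsto_const_nhds (x := D)).add (tendsto_one_div_atTop_nhds_zero_nat (𝕜 := ℝ))
  rw [← hlim.liminf_eq]
  refine liminf_le_liminf ?_
  filter_upwards [eventually_gt_atTop 0] with n hn
  have hn0 : (0 : EReal) < (n : EReal) := by exact_mod_cast hn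
  rw [EReal.div_le_iff_le_mul hn0 (EReal.natCast_ne_top n)]
  refine (hypothesisTestingEntropy_le hD hε hε1 n).trans (le_of_eq ?_)
  rw [← EReal.coe_natCast, ← EReal.coe_mul]
  congr 1
  have : (n : ℝ) ≠ 0 := by exact_mod_cast hn.ne'
  rw [← hDdef]
  field_simp

/-- The Stein exponent is the umlaut information for every joint law that is absolutely continuous
with respect to the product of its marginals. -/
lemma hasSteinExponent_umlautInformation {P : Measure (X × Y)} [IsProbabilityMeasure P]
    (hP : P ≪ P.fst.prod P.snd) :
    HasSteinExponent (productHypotheses P.fst) P (umlautInformation P : EReal) := by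
  refine tendsto_order.2 ⟨fun a ha => ?_, fun c hc => ?_⟩
  · obtain ⟨b, hab, hb⟩ := EReal.lt_iff_exists_real_btwn.1 ha
    filter_upwards [self_mem_nhdsWithin] with ε hε
    exact hab.trans_le (le_liminf_of_lt_umlautInformation hP hb hε)
  · obtain ⟨r, hr, hrc⟩ := EReal.lt_iff_exists_real_btwn.1 hc
    have hr0 : 0 ≤ r := by
      exact_mod_cast ((EReal.coe_ennreal_nonneg (umlautInformation P)).trans hr.le)
    have hr' : umlautInformation P < ENNReal.ofReal r := by
      rw [← EReal.coe_ennreal_lt_coe_ennreal_iff, EReal.coe_ennreal_ofReal, max_eq_left hr0]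
      exact hr
    obtain ⟨ν, hν⟩ := iInf_lt_iff.1 hr'
    have hD : InformationTheory.klDiv (P.fst.prod (ν : Measure Y)) P ≠ ∞ := hν.ne_top
    have hDr := (ENNReal.lt_ofReal_iff_toReal_lt hD).1 hν
    have hlim : Tendsto (fun ε : ℝ =>
        (InformationTheory.klDiv (P.fst.prod (ν : Measure Y)) P).toReal / (1 - ε)) (𝓝[>] 0)
        (𝓝 (InformationTheory.klDiv (P.fst.prod (ν : Measure Y)) P).toReal) := by
      have h1 : Tendsto (fun ε : ℝ => 1 - ε) (𝓝[>] 0) (𝓝 1) := by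
        have hc : Continuous fun ε : ℝ => 1 - ε := by fun_prop
        simpa using (hc.tendsto 0).mono_left nhdsWithin_le_nhds
      have h2 := (tendsto_const_nhds
        (x := (InformationTheory.klDiv (P.fst.prod (ν : Measure Y)) P).toReal)).div h1 one_ne_zero
      rw [div_one] at h2
      exact h2
    filter_upwards [self_mem_nhdsWithin, hlim.eventually (gt_mem_nhds hDr),
      nhdsWithin_le_nhds (gt_mem_nhds zero_lt_one)] with ε hε hεr hε1
    exact (liminf_le_of_klDiv hD hε hε1).trans_lt ((EReal.coe_lt_coe_iff.2 hεr).trans hrc)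

end Exponent

end Umlaut

/-- The Stein exponent of testing `P_X^{× n} × Q_{Y^n}`, with `Q_{Y^n}` arbitrary, against
`P_{XY}^{× n}` is the umlaut information, for every joint law with a density on `ℝ^{d₁} × ℝ^{d₂}`. -/
theorem mainTheorem11 (d₁ d₂ : ℕ)
    (P : MeasureTheory.Measure (EuclideanSpace ℝ (Fin d₁) × EuclideanSpace ℝ (Fin d₂)))
    [MeasureTheory.IsProbabilityMeasure P]
    (hP : MeasureTheory.Measure.AbsolutelyContinuous P MeasureTheory.volume) :
    Umlaut.HasSteinExponent (Umlaut.productHypotheses P.fst) P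
      ((Umlaut.umlautInformation P : ENNReal) : EReal) :=
  Umlaut.hasSteinExponent_umlautInformation
    (Umlaut.absolutelyContinuous_prod_marginals (by rwa [Measure.volume_eq_prod] at hP))
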